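/- Let $\langle f,g\rangle_F=\int_{\mathbb R}f(x)g(x)e^{-x^4}\,dx$ and let $(P_n)_{n\ge 0}$ be the monic orthogonal polynomials ($\deg P_n=n$) with respect to $\langle\cdot,\cdot\rangle_F$. For $\lambda_1\ge 0$, let $(Q_n)_{n\ge 0}$ be the monic orthogonal polynomials ($\deg Q_n=n$) with respect to the inner product $$\langle f,g\rangle_S=\int_{\mathbb R}f(x)g(x)e^{-x^4}\,dx+\lambda_1 f(0)g(0)+\lambda_2 f'(0)g'(0)\qquad\text{with }\lambda_2=0 .$$ Let $\varphi(z)=z+\sqrt{z^2-1}$ for $z\in\mathbb C\setminus[-1,1]$, where the branch of the square root is holomorphic on $\mathbb C\setminus[-1,1]$ with $\sqrt{z^2-1}>0$ for $z>1$ (so $\varphi$ is the conformal map of $\mathbb C\setminus[-1,1]$ onto the exterior of the closed unit disk). Then for every compact set $K\subset\mathbb C\setminus\big[-\sqrt[4]{4/3},\sqrt[4]{4/3}\big]$, one has $P_n(\sqrt[4]{n}\,x)\neq 0$ for all $x\in K$ and all sufficiently large $n$, and $$\lim_{n\to\infty}\frac{Q_n(\sqrt[4]{n}\,x)}{P_n(\sqrt[4]{n}\,x)}=\sqrt[4]{12}\;\frac{x\,\varphi\big(\sqrt[4]{3/4}\,x\big)}{1+\varphi^2\big(\sqrt[4]{3/4}\,x\big)}\qquad\text{uniformly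 for } x\in K .$$ -/

import Mathlib

open Polynomial MeasureTheory Filter

noncomputable section

namespace FreudSobolev

/-! ### Monic orthogonal polynomials of a bilinear form on real polynomials -/

/-- `p` is a sequence of monic orthogonal polynomials (with `deg p n = n`) for the form `B`. -/
structure IsMonicOrthogonal (B : LinearMap.BilinForm ℝ ℝ[X]) (p : ℕ → ℝ[X]) : Prop where
  monic : ∀ n, (p n).Monic
  natDegree_eq : ∀ n, (p n).natDegree = n
  orthogonal : ∀ m n, m ≠ n → B (p m) (p n) = 0

/-- The monic orthogonal polynomials of `B`, by the Gram-Schmidt process applied to `1, X, X², …`.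
For a symmetric positive definite `B` this is the only sequence with `IsMonicOrthogonal B`, see
`isMonicOrthogonal_iff`. -/
def monicOrtho (B : LinearMap.BilinForm ℝ ℝ[X]) : ℕ → ℝ[X]
  | n => X ^ n - ∑ k : Fin n,
      C (B (X ^ n) (monicOrtho B k) / B (monicOrtho B k) (monicOrtho B k)) * monicOrtho B k

theorem monicOrtho_eq (B : LinearMap.BilinForm ℝ ℝ[X]) (n : ℕ) :
    monicOrtho B n = X ^ n - ∑ k : Fin n,
      C (B (X ^ n) (monicOrtho B k) / B (monicOrtho B k) (monicOrtho B k)) * monicOrtho B k := by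
  rw [monicOrtho]

theorem monicOrtho_degree (B : LinearMap.BilinForm ℝ ℝ[X]) (n : ℕ) :
    (monicOrtho B n).Monic ∧ (monicOrtho B n).natDegree = n := by
  induction n using Nat.strong_induction_on with
  | _ n ih =>
    have hs : (∑ k : Fin n, C (B (X ^ n) (monicOrtho B k) / B (monicOrtho B k) (monicOrtho B k)) *
        monicOrtho B k).degree < (n : WithBot ℕ) := by
      refine (Polynomial.degree_sum_le _ _).trans_lt ?_
      refine (Finset.sup_lt_iff (WithBot.bot_lt_coe n)).2 fun k _ => ?_
      rw [← smul_eq_C_mul]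
      refine (Polynomial.degree_smul_le _ _).trans_lt ?_
      refine Polynomial.degree_le_natDegree.trans_lt ?_
      rw [(ih k k.2).2]
      exact WithBot.coe_lt_coe.2 k.2
    have hm : (monicOrtho B n).Monic := by
      rw [monicOrtho_eq]
      exact Polynomial.monic_X_pow_sub hs
    refine ⟨hm, ?_⟩
    apply Polynomial.natDegree_eq_of_degree_eq_some
    rw [monicOrtho_eq, Polynomial.degree_sub_eq_left_of_degree_lt] <;> simp [hs]

theorem monicOrtho_orthogonal (B : LinearMap.BilinForm ℝ ℝ[X]) (hsymm : ∀ f g, B f g = B g f)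
    (hpos : ∀ f, f ≠ 0 → 0 < B f f) (n : ℕ) :
    ∀ m < n, B (monicOrtho B n) (monicOrtho B m) = 0 := by
  induction n using Nat.strong_induction_on with
  | _ n ih =>
    intro m hm
    have h0 : B (monicOrtho B m) (monicOrtho B m) ≠ 0 :=
      (hpos _ (monicOrtho_degree B m).1.ne_zero).ne'
    rw [monicOrtho_eq B n]
    simp only [map_sub, map_sum, LinearMap.sub_apply, LinearMap.sum_apply, ← smul_eq_C_mul,
      map_smul, LinearMap.smul_apply, smul_eq_mul]
    rw [Finset.sum_eq_single (⟨m, hm⟩ : Fin n)]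
    · field_simp
      simp
    · intro k _ hk
      have hkm : (k : ℕ) ≠ m := fun h => hk (Fin.ext h)
      rcases lt_or_gt_of_ne hkm with h | h
      · rw [hsymm (monicOrtho B k) (monicOrtho B m), ih m hm k h, mul_zero]
      · rw [ih k k.2 m h, mul_zero]
    · simp

theorem IsMonicOrthogonal.eq_zero_of_degree_lt {B : LinearMap.BilinForm ℝ ℝ[X]} {p : ℕ → ℝ[X]}
    (hp : IsMonicOrthogonal B p) (n : ℕ) (f : ℝ[X]) (hf : f.degree < n) : B f (p n) = 0 := by
  have key : ∀ m ≤ n, ∀ f : ℝ[X], f.degree < m → B f (p n) = 0 := by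
    intro m
    induction m with
    | zero =>
      intro _ f hf
      have : f = 0 := by
        ext j
        simpa using (Polynomial.degree_lt_iff_coeff_zero f 0).1 hf j (Nat.zero_le j)
      simp [this]
    | succ m ih =>
      intro hmn f hf
      have hr := ih (by omega) (f - f.coeff m • p m) (by
        rw [Polynomial.degree_lt_iff_coeff_zero]
        intro j hj
        rcases hj.eq_or_lt with rfl | hj
        · have := hp.monic m
          rw [Polynomial.Monic, Polynomial.leadingCoeff, hp.natDegree_eq] at this
          simp [this]
        · have h1 := (Polynomial.degree_lt_iff_coeff_zero f (m + 1)).1 hf j hj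
          have h2 : (p m).coeff j = 0 :=
            Polynomial.coeff_eq_zero_of_natDegree_lt (by rw [hp.natDegree_eq]; exact hj)
          simp [h1, h2])
      simpa [hp.orthogonal m n (by omega)] using hr
  exact key n le_rfl f hf

theorem isMonicOrthogonal_iff (B : LinearMap.BilinForm ℝ ℝ[X]) (hsymm : ∀ f g, B f g = B g f)
    (hpos : ∀ f, f ≠ 0 → 0 < B f f) (p : ℕ → ℝ[X]) :
    IsMonicOrthogonal B p ↔ p = monicOrtho B := by
  have hex : IsMonicOrthogonal B (monicOrtho B) := by
    refine ⟨fun n => (monicOrtho_degree B n).1, fun n => (monicOrtho_degree B n).2, ?_⟩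
    intro m n hmn
    rcases lt_or_gt_of_ne hmn with h | h
    · rw [hsymm]
      exact monicOrtho_orthogonal B hsymm hpos n m h
    · exact monicOrtho_orthogonal B hsymm hpos m n h
  refine ⟨fun hp => ?_, fun h => h ▸ hex⟩
  funext n
  by_contra hne
  have hd : (p n - monicOrtho B n).degree < n := by
    have hn : (p n).degree = n := by
      rw [Polynomial.degree_eq_natDegree (hp.monic n).ne_zero, hp.natDegree_eq]
    rw [← hn]
    refine Polynomial.degree_sub_lt_left ?_ (hp.monic n).ne_zero ?_
    · rw [hn, Polynomial.degree_eq_natDegree (hex.monic n).ne_zero, hex.natDegree_eq]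
    · rw [(hp.monic n).leadingCoeff, (hex.monic n).leadingCoeff]
  have h1 := hp.eq_zero_of_degree_lt n _ hd
  have h2 := hex.eq_zero_of_degree_lt n _ hd
  have h3 := hpos _ (sub_ne_zero.2 hne)
  rw [map_sub, h1, h2, sub_zero] at h3
  exact lt_irrefl _ h3

/-! ### The Freud inner product and the Sobolev inner product -/

theorem integrable_pow_mul_exp_neg_pow_four (n : ℕ) :
    Integrable fun x : ℝ => x ^ n * Real.exp (-x ^ 4) := by
  have h := integrable_rpow_mul_exp_neg_mul_sq (b := 1) one_pos (s := n)
    (by have : (0 : ℝ) ≤ n := n.cast_nonneg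
        linarith)
  simp only [Real.rpow_natCast] at h
  refine (h.norm.const_mul (Real.exp 1)).mono' (by fun_prop) (Eventually.of_forall fun x => ?_)
  rw [norm_mul, norm_mul, mul_left_comm, Real.norm_of_nonneg (Real.exp_pos _).le,
    Real.norm_of_nonneg (Real.exp_pos _).le, ← Real.exp_add]
  refine mul_le_mul_of_nonneg_left (Real.exp_le_exp.2 ?_) (norm_nonneg _)
  nlinarith [sq_nonneg (x ^ 2 - 1), sq_nonneg x]

theorem integrable_eval_mul_exp (f : ℝ[X]) :
    Integrable fun x : ℝ => f.eval x * Real.exp (-x ^ 4) := by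
  simp only [Polynomial.eval_eq_sum_range, Finset.sum_mul, mul_assoc]
  exact integrable_finsetSum _ fun i _ => (integrable_pow_mul_exp_neg_pow_four i).const_mul _

theorem integrable_eval_mul_eval_mul_exp (f g : ℝ[X]) :
    Integrable fun x : ℝ => f.eval x * g.eval x * Real.exp (-x ^ 4) := by
  simpa using integrable_eval_mul_exp (f * g)

/-- The Freud inner product `⟨f, g⟩_F = ∫ f(x) g(x) exp(-x⁴) dx` on real polynomials. -/
def freudForm : LinearMap.BilinForm ℝ ℝ[X] :=
  LinearMap.mk₂ ℝ (fun f g => ∫ x : ℝ, f.eval x * g.eval x * Real.exp (-x ^ 4))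
    (fun f₁ f₂ g => by
      rw [← integral_add (integrable_eval_mul_eval_mul_exp f₁ g)
        (integrable_eval_mul_eval_mul_exp f₂ g)]
      simp only [Polynomial.eval_add, add_mul])
    (fun c f g => by
      rw [smul_eq_mul, ← integral_const_mul]
      simp only [Polynomial.eval_smul, smul_eq_mul, mul_assoc])
    (fun f g₁ g₂ => by
      rw [← integral_add (integrable_eval_mul_eval_mul_exp f g₁)
        (integrable_eval_mul_eval_mul_exp f g₂)]
      simp only [Polynomial.eval_add, mul_add, add_mul])
    (fun c f g => by
      rw [smul_eq_mul, ← integral_const_mul]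
      simp only [Polynomial.eval_smul, smul_eq_mul, mul_assoc, mul_left_comm])

/-- The Sobolev inner product
`⟨f, g⟩_S = ∫ f(x) g(x) exp(-x⁴) dx + l₁ f(0) g(0) + l₂ f'(0) g'(0)` on real polynomials. -/
def sobolevForm (l₁ l₂ : ℝ) : LinearMap.BilinForm ℝ ℝ[X] :=
  LinearMap.mk₂ ℝ (fun f g => (∫ x : ℝ, f.eval x * g.eval x * Real.exp (-x ^ 4)) +
      l₁ * f.eval 0 * g.eval 0 + l₂ * f.derivative.eval 0 * g.derivative.eval 0)
    (fun f₁ f₂ g => by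
      change freudForm _ _ + _ + _ = freudForm _ _ + _ + _ + (freudForm _ _ + _ + _)
      simp only [map_add, LinearMap.add_apply, Polynomial.eval_add]
      ring)
    (fun c f g => by
      change freudForm _ _ + _ + _ = c • (freudForm _ _ + _ + _)
      simp only [map_smul, LinearMap.smul_apply, Polynomial.eval_smul, smul_eq_mul]
      ring)
    (fun f g₁ g₂ => by
      change freudForm _ _ + _ + _ = freudForm _ _ + _ + _ + (freudForm _ _ + _ + _)
      simp only [map_add, Polynomial.eval_add]
      ring)
    (fun c f g => by
      change freudForm _ _ + _ + _ = c • (freudForm _ _ + _ + _)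
      simp only [map_smul, Polynomial.eval_smul, smul_eq_mul]
      ring)

theorem freudForm_apply (f g : ℝ[X]) :
    freudForm f g = ∫ x : ℝ, f.eval x * g.eval x * Real.exp (-x ^ 4) := rfl

theorem sobolevForm_apply (l₁ l₂ : ℝ) (f g : ℝ[X]) :
    sobolevForm l₁ l₂ f g = (∫ x : ℝ, f.eval x * g.eval x * Real.exp (-x ^ 4)) +
      l₁ * f.eval 0 * g.eval 0 + l₂ * f.derivative.eval 0 * g.derivative.eval 0 := rfl

theorem freudForm_symm (f g : ℝ[X]) : freudForm f g = freudForm g f := by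
  simp only [freudForm_apply, mul_comm (f.eval _)]

theorem sobolevForm_symm (l₁ l₂ : ℝ) (f g : ℝ[X]) :
    sobolevForm l₁ l₂ f g = sobolevForm l₁ l₂ g f := by
  simp only [sobolevForm_apply, mul_comm (f.eval _)]
  ring

theorem freudForm_pos (f : ℝ[X]) (hf : f ≠ 0) : 0 < freudForm f f := by
  rw [freudForm_apply]
  have hc : Continuous fun x : ℝ => f.eval x * f.eval x * Real.exp (-x ^ 4) := by fun_prop
  obtain ⟨x, hx⟩ : ∃ x, f.eval x ≠ 0 := by
    by_contra h
    push Not at h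
    exact hf (Polynomial.funext fun x => by simpa using h x)
  refine integral_pos_of_integrable_nonneg_nonzero (x := x) hc
    (integrable_eval_mul_eval_mul_exp f f) (fun y => ?_) ?_
  · exact mul_nonneg (mul_self_nonneg _) (Real.exp_pos _).le
  · exact mul_ne_zero (mul_ne_zero hx hx) (Real.exp_pos _).ne'

theorem sobolevForm_pos (l₁ l₂ : ℝ) (h₁ : 0 ≤ l₁) (h₂ : 0 ≤ l₂) (f : ℝ[X]) (hf : f ≠ 0) :
    0 < sobolevForm l₁ l₂ f f := by
  have h := freudForm_pos f hf
  rw [freudForm_apply] at h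
  rw [sobolevForm_apply, mul_assoc, mul_assoc]
  have h3 := mul_nonneg h₁ (mul_self_nonneg (f.eval 0))
  have h4 := mul_nonneg h₂ (mul_self_nonneg (f.derivative.eval 0))
  linarith

/-- `P_n`: the monic polynomials orthogonal for the weight `exp(-x⁴)`. -/
def freudPoly (n : ℕ) : ℝ[X] := monicOrtho freudForm n

/-- `Q_n`: the monic polynomials orthogonal for the Sobolev inner product. -/
def sobolevPoly (l₁ l₂ : ℝ) (n : ℕ) : ℝ[X] := monicOrtho (sobolevForm l₁ l₂) n

theorem isMonicOrthogonal_freudForm_iff (p : ℕ → ℝ[X]) :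
    IsMonicOrthogonal freudForm p ↔ p = freudPoly :=
  isMonicOrthogonal_iff _ freudForm_symm freudForm_pos p

theorem isMonicOrthogonal_sobolevForm_iff (l₁ l₂ : ℝ) (h₁ : 0 ≤ l₁) (h₂ : 0 ≤ l₂)
    (p : ℕ → ℝ[X]) :
    IsMonicOrthogonal (sobolevForm l₁ l₂) p ↔ p = sobolevPoly l₁ l₂ :=
  isMonicOrthogonal_iff _ (sobolevForm_symm l₁ l₂) (sobolevForm_pos l₁ l₂ h₁ h₂) p

/-! ### The conformal map of the complement of `[-1, 1]` onto the exterior of the unit disk -/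

/-- The real segment `[-a, a]` as a subset of `ℂ`. -/
def realSegment (a : ℝ) : Set ℂ := (fun t : ℝ => (t : ℂ)) '' Set.Icc (-a) a

/-- `φ(z) = z + √(z² - 1)`. The branch of `√(z² - 1)` that is holomorphic off `[-1, 1]` and positive
for `z > 1` is `z * (1 - 1 / z²) ^ (1/2)` with the principal power, because `1 - 1 / z²` is a
nonpositive real only for `z` in `[-1, 1]`. -/
def phi (z : ℂ) : ℂ := z + z * (1 - 1 / z ^ 2) ^ (1 / 2 : ℂ)

theorem ne_zero_of_notMem_realSegment {z : ℂ} (hz : z ∉ realSegment 1) : z ≠ 0 := by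
  rintro rfl
  exact hz ⟨0, by simp, by simp⟩

theorem one_sub_mem_slitPlane {z : ℂ} (hz : z ∉ realSegment 1) :
    1 - 1 / z ^ 2 ∈ Complex.slitPlane := by
  have h0 := ne_zero_of_notMem_realSegment hz
  rw [Complex.mem_slitPlane_iff_not_le_zero]
  intro hle
  obtain ⟨hre, him⟩ := Complex.le_def.1 hle
  set w : ℂ := 1 / z ^ 2 with hw
  have hwre : 1 ≤ w.re := by simpa using hre
  have hwim : w.im = 0 := by simpa using him
  have hz2 : z ^ 2 = ((w.re⁻¹ : ℝ) : ℂ) := by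
    have : w = (w.re : ℂ) := Complex.ext (by simp) (by simpa using hwim)
    rw [Complex.ofReal_inv, ← this, hw]
    simp
  have hr : 0 ≤ w.re⁻¹ := by positivity
  have hr1 : Real.sqrt w.re⁻¹ ≤ 1 := by
    exact Real.sqrt_le_one.2 (inv_le_one_of_one_le₀ hwre)
  have hsq : z ^ 2 = ((Real.sqrt w.re⁻¹ : ℝ) : ℂ) ^ 2 := by
    rw [hz2, ← Complex.ofReal_pow, Real.sq_sqrt hr]
  have hs0 := Real.sqrt_nonneg w.re⁻¹
  rcases sq_eq_sq_iff_eq_or_eq_neg.1 hsq with h | h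
  · exact hz ⟨_, ⟨by linarith, hr1⟩, h.symm⟩
  · exact hz ⟨-Real.sqrt w.re⁻¹, ⟨by linarith, by linarith⟩, by simp [h]⟩

theorem phi_sub_sq {z : ℂ} (hz : z ∉ realSegment 1) : (phi z - z) ^ 2 = z ^ 2 - 1 := by
  have h0 := ne_zero_of_notMem_realSegment hz
  rw [phi, add_sub_cancel_left, mul_pow, ← Complex.cpow_nat_mul]
  norm_num
  field_simp

theorem phi_ofReal {x : ℝ} (hx : 1 < x) : phi x = ((x + Real.sqrt (x ^ 2 - 1) : ℝ) : ℂ) := by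
  have hx0 : 0 < x := by linarith
  have h1 : 0 ≤ 1 - 1 / x ^ 2 := by
    have : 1 / x ^ 2 ≤ 1 := by
      rw [div_le_one (by positivity)]
      nlinarith
    linarith
  have h2 : x ^ 2 - 1 = x ^ 2 * (1 - 1 / x ^ 2) := by field_simp
  have h3 : (1 - 1 / (x : ℂ) ^ 2) ^ (1 / 2 : ℂ) = ((Real.sqrt (1 - 1 / x ^ 2) : ℝ) : ℂ) := by
    rw [Real.sqrt_eq_rpow, Complex.ofReal_cpow h1]
    push_cast
    rfl
  rw [phi, h3, h2, Real.sqrt_mul (by positivity), Real.sqrt_sq hx0.le]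
  push_cast
  rfl

theorem differentiableOn_phi : DifferentiableOn ℂ phi (realSegment 1)ᶜ := by
  intro z hz
  have h0 := ne_zero_of_notMem_realSegment hz
  have h1 : DifferentiableAt ℂ (fun z : ℂ => 1 - 1 / z ^ 2) z :=
    (differentiableAt_const _).sub
      ((differentiableAt_const _).div (by fun_prop) (pow_ne_zero 2 h0))
  have h2 := h1.cpow (differentiableAt_const (1 / 2 : ℂ)) (one_sub_mem_slitPlane hz)
  exact (differentiableAt_id.add (differentiableAt_id.mul h2)).differentiableWithinAt

end FreudSobolev

end

noncomputable section

namespace FreudSobolev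

/-! The limit function is the constant 1: the relation (φ(z) - z)² = z² - 1 gives 1 + φ(z)² =
2zφ(z), and 12^(1/4) = 2·(3/4)^(1/4). The claim is therefore that the point mass at 0 becomes
invisible away from the limiting interval of zeros.

Let h_n be the squared norm of P_n, a_n = h_n / h_{n-1} the recurrence coefficient and d_n = P_n(0)²
/ h_n. The polynomial Q_n differs from P_n by a multiple of the kernel K_{n-1}(·, 0). Consecutive
P_n never both contribute at 0 because of parity, so Christoffel–Darboux leaves a single term
(`X_mul_eval_smul_freudKernel`) and Q_n(z)/P_n(z) - 1 = [λ₁ d_n / (1 + λ₁ ∑_{k<n} d_k)] · a_n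
P_{n-1}(z) / (z P_n(z)).

The bracket tends to 0: d_{n+2}/d_n = a_{n+1}/a_{n+2} tends to 1, so each d_n is negligible against
the sum of its predecessors (`eventually_mul_freudDiag_le`). The other factor stays bounded at z =
n^(1/4) x: a_n ≤ √n/2, |z| is at least of order n^(1/4), and |P_{n-1}/P_n| is at most of order
n^(-1/4) off the numerical range of the truncated Jacobi matrix (`norm_aeval_freudPoly_le`).

Both facts rest on a_n/√n → 1/√12 (`tendsto_freudCoeff_div_sqrt`), derived from the Freud equation
4a_n(a_{n+1} + a_n + a_{n-1}) = n. It also places the numerical range asymptotically in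
n^(1/4)·[-(4/3)^(1/4), (4/3)^(1/4)]. -/

theorem IsMonicOrthogonal.linearMap_eq_zero {B : LinearMap.BilinForm ℝ ℝ[X]} {p : ℕ → ℝ[X]}
    (hp : IsMonicOrthogonal B p) {M : Type*} [AddCommGroup M] [Module ℝ M] (l : ℝ[X] →ₗ[ℝ] M)
    (n : ℕ) (hl : ∀ k < n, l (p k) = 0) (f : ℝ[X]) (hf : f.degree < n) : l f = 0 := by
  induction n generalizing f with
  | zero =>
    have : f = 0 := by
      ext j
      simpa using (Polynomial.degree_lt_iff_coeff_zero f 0).1 hf j (Nat.zero_le j)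
    simp [this]
  | succ m ih =>
    have hr := ih (fun k hk => hl k (by omega)) (f - f.coeff m • p m) (by
      rw [Polynomial.degree_lt_iff_coeff_zero]
      intro j hj
      rcases hj.eq_or_lt with rfl | hj
      · have := hp.monic m
        rw [Polynomial.Monic, Polynomial.leadingCoeff, hp.natDegree_eq] at this
        simp [this]
      · have h1 := (Polynomial.degree_lt_iff_coeff_zero f (m + 1)).1 hf j hj
        have h2 : (p m).coeff j = 0 :=
          Polynomial.coeff_eq_zero_of_natDegree_lt (by rw [hp.natDegree_eq]; exact hj)
        simp [h1, h2])
    simpa [hl m (by omega)] using hr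

/-! ### Orthogonality, parity and the three-term recurrence -/

theorem isMonicOrthogonal_freudPoly : IsMonicOrthogonal freudForm freudPoly :=
  (isMonicOrthogonal_freudForm_iff _).2 rfl

theorem freudPoly_monic (n : ℕ) : (freudPoly n).Monic := isMonicOrthogonal_freudPoly.monic n

theorem freudPoly_natDegree (n : ℕ) : (freudPoly n).natDegree = n :=
  isMonicOrthogonal_freudPoly.natDegree_eq n

theorem freudPoly_degree (n : ℕ) : (freudPoly n).degree = n := by
  rw [degree_eq_natDegree (freudPoly_monic n).ne_zero, freudPoly_natDegree]

theorem freudForm_freudPoly_of_ne {m n : ℕ} (h : m ≠ n) :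
    freudForm (freudPoly m) (freudPoly n) = 0 :=
  isMonicOrthogonal_freudPoly.orthogonal m n h

theorem freudForm_freudPoly_of_degree_lt {n : ℕ} {f : ℝ[X]} (hf : f.degree < n) :
    freudForm f (freudPoly n) = 0 :=
  isMonicOrthogonal_freudPoly.eq_zero_of_degree_lt n f hf

theorem freudPoly_zero : freudPoly 0 = 1 :=
  (freudPoly_monic 0).natDegree_eq_zero.1 (freudPoly_natDegree 0)

/-- The squared norm of `P_n`. -/
def freudNorm (n : ℕ) : ℝ := freudForm (freudPoly n) (freudPoly n)

theorem freudNorm_pos (n : ℕ) : 0 < freudNorm n :=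
  freudForm_pos _ (freudPoly_monic n).ne_zero

theorem freudForm_mul_left (f g k : ℝ[X]) : freudForm (f * g) k = freudForm f (g * k) := by
  simp only [freudForm_apply, eval_mul, mul_assoc]

theorem freudForm_comp_neg (f g : ℝ[X]) :
    freudForm (f.comp (-X)) (g.comp (-X)) = freudForm f g := by
  rw [freudForm_apply, freudForm_apply,
    ← integral_neg_eq_self (fun x : ℝ => f.eval x * g.eval x * Real.exp (-x ^ 4))]
  simp [Even.neg_pow (show Even 4 by decide)]

/-- The weight is even, so the reflected and sign-normalised sequence is again monic orthogonal;
uniqueness identifies it with the original one. -/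
theorem freudPoly_comp_neg (n : ℕ) : (freudPoly n).comp (-X) = (-1) ^ n * freudPoly n := by
  have h : IsMonicOrthogonal freudForm fun n => C ((-1) ^ n) * (freudPoly n).comp (-X) := by
    have hd : ∀ n, (C ((-1 : ℝ) ^ n) * (freudPoly n).comp (-X)).natDegree = n := fun n => by
      rw [natDegree_C_mul (by simp), natDegree_comp, freudPoly_natDegree]
      simp
    refine ⟨fun n => ?_, hd, fun m n hmn => ?_⟩
    · rw [Monic, leadingCoeff_mul, leadingCoeff_C, leadingCoeff_comp (by simp),
        (freudPoly_monic n).leadingCoeff, freudPoly_natDegree, leadingCoeff_neg, leadingCoeff_X,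
        one_mul, ← mul_pow]
      simp
    · simp only [← smul_eq_C_mul, map_smul, LinearMap.smul_apply, freudForm_comp_neg,
        freudForm_freudPoly_of_ne hmn, smul_zero]
  have h2 := congrFun ((isMonicOrthogonal_freudForm_iff _).1 h) n
  have h3 : ((-1 : ℝ[X]) ^ n) * ((-1) ^ n) = 1 := by rw [← mul_pow]; simp
  calc (freudPoly n).comp (-X) = (-1) ^ n * ((-1) ^ n * (freudPoly n).comp (-X)) := by
        rw [← mul_assoc, h3, one_mul]
    _ = (-1) ^ n * freudPoly n := congrArg ((-1) ^ n * ·) (by simpa using h2)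

theorem freudForm_X_mul_freudPoly_self (n : ℕ) :
    freudForm (X * freudPoly n) (freudPoly n) = 0 := by
  have h := freudForm_comp_neg (X * freudPoly n) (freudPoly n)
  have h3 : ((-1 : ℝ) ^ n) * ((-1) ^ n) = 1 := by rw [← mul_pow]; simp
  rw [mul_comp, freudPoly_comp_neg, X_comp] at h
  have e : -X * ((-1) ^ n * freudPoly n) = (-(-1 : ℝ) ^ n) • (X * freudPoly n) := by
    rw [smul_eq_C_mul]; simp; ring
  have e2 : (-1) ^ n * freudPoly n = ((-1 : ℝ) ^ n) • freudPoly n := by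
    rw [smul_eq_C_mul]; simp
  rw [e, e2] at h
  simp only [map_smul, LinearMap.smul_apply, smul_eq_mul] at h
  rw [← mul_assoc, mul_neg, h3] at h
  linarith

theorem eval_zero_freudPoly_mul (n : ℕ) :
    (freudPoly (n + 1)).eval 0 * (freudPoly n).eval 0 = 0 := by
  have h (k : ℕ) : (freudPoly k).eval 0 = (-1) ^ k * (freudPoly k).eval 0 := by
    simpa using congrArg (eval 0) (freudPoly_comp_neg k)
  have h0 := h n
  have h1 := h (n + 1)
  rcases neg_one_pow_eq_or ℝ n with e | e
  · rw [pow_succ, e] at h1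
    rw [show (freudPoly (n + 1)).eval 0 = 0 by linarith, zero_mul]
  · rw [e] at h0
    rw [show (freudPoly n).eval 0 = 0 by linarith, mul_zero]

/-- The coefficients in the three term recurrence of the polynomials `P_n`. -/
def freudCoeff : ℕ → ℝ
  -- The value 0 makes the recurrence valid at n = 0, where the truncated index n - 1 is again 0.
  | 0 => 0
  | n + 1 => freudNorm (n + 1) / freudNorm n

theorem freudCoeff_zero : freudCoeff 0 = 0 := rfl

theorem freudCoeff_succ_mul (n : ℕ) : freudCoeff (n + 1) * freudNorm n = freudNorm (n + 1) :=
  div_mul_cancel₀ _ (freudNorm_pos n).ne'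

theorem freudCoeff_succ_pos (n : ℕ) : 0 < freudCoeff (n + 1) :=
  div_pos (freudNorm_pos _) (freudNorm_pos _)

theorem freudCoeff_nonneg : ∀ n, 0 ≤ freudCoeff n
  | 0 => le_rfl
  | n + 1 => (freudCoeff_succ_pos n).le

theorem eq_freudPoly_of_monic {n : ℕ} {f : ℝ[X]} (hm : f.Monic) (hd : f.natDegree = n)
    (h : ∀ k < n, freudForm f (freudPoly k) = 0) : f = freudPoly n := by
  by_contra hne
  have hdeg : (f - freudPoly n).degree < n := by
    have hn : f.degree = n := by rw [degree_eq_natDegree hm.ne_zero, hd]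
    rw [← hn]
    refine degree_sub_lt_left (by rw [hn, freudPoly_degree]) hm.ne_zero ?_
    rw [hm.leadingCoeff, (freudPoly_monic n).leadingCoeff]
  have h1 : freudForm f (f - freudPoly n) = 0 :=
    isMonicOrthogonal_freudPoly.linearMap_eq_zero (freudForm f) n h _ hdeg
  have h2 := freudForm_freudPoly_of_degree_lt hdeg
  have h3 := freudForm_pos _ (sub_ne_zero.2 hne)
  rw [LinearMap.map_sub₂, h1, freudForm_symm, h2, sub_zero] at h3
  exact lt_irrefl _ h3

theorem freudForm_X_mul_freudPoly_succ (n : ℕ) :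
    freudForm (X * freudPoly n) (freudPoly (n + 1)) = freudNorm (n + 1) := by
  have hd : (X * freudPoly n - freudPoly (n + 1)).degree < ((n + 1 : ℕ) : WithBot ℕ) := by
    have hn : (X * freudPoly n).degree = ((n + 1 : ℕ) : WithBot ℕ) := by
      rw [degree_mul, degree_X, freudPoly_degree, add_comm]; rfl
    rw [← hn]
    refine degree_sub_lt_left (by rw [hn, freudPoly_degree])
      (monic_X.mul (freudPoly_monic n)).ne_zero ?_
    rw [(monic_X.mul (freudPoly_monic n)).leadingCoeff, (freudPoly_monic _).leadingCoeff]
  have h := freudForm_freudPoly_of_degree_lt hd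
  rw [map_sub, LinearMap.sub_apply] at h
  exact sub_eq_zero.1 h

theorem X_mul_freudPoly (n : ℕ) :
    X * freudPoly n = freudPoly (n + 1) + C (freudCoeff n) * freudPoly (n - 1) := by
  have hm := monic_X.mul (freudPoly_monic n)
  have hn : (X * freudPoly n).degree = ((n + 1 : ℕ) : WithBot ℕ) := by
    rw [degree_mul, degree_X, freudPoly_degree, add_comm]; rfl
  have hlt : (C (freudCoeff n) * freudPoly (n - 1)).degree < (X * freudPoly n).degree := by
    rw [hn, ← smul_eq_C_mul]
    refine (degree_smul_le _ _).trans_lt ?_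
    rw [freudPoly_degree]
    exact_mod_cast (by omega : n - 1 < n + 1)
  rw [← sub_eq_iff_eq_add]
  refine eq_freudPoly_of_monic (hm.sub_of_left hlt) ?_ fun k hk => ?_
  · apply natDegree_eq_of_degree_eq_some
    rw [degree_sub_eq_left_of_degree_lt hlt, hn]
  · rw [← smul_eq_C_mul, map_sub, map_smul, LinearMap.sub_apply, LinearMap.smul_apply, smul_eq_mul]
    rcases (Nat.lt_succ_iff.1 hk).eq_or_lt with rfl | hk
    · rw [freudForm_X_mul_freudPoly_self]
      rcases k with _ | k
      · simp [freudCoeff_zero]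
      · rw [freudForm_freudPoly_of_ne (by omega)]; simp
    · obtain ⟨m, rfl⟩ : ∃ m, n = m + 1 := ⟨n - 1, by omega⟩
      rw [mul_comm X, freudForm_mul_left, freudForm_symm]
      rcases (Nat.lt_succ_iff.1 hk).eq_or_lt with rfl | hk
      · rw [freudForm_X_mul_freudPoly_succ, Nat.add_sub_cancel]
        exact sub_eq_zero.2 (freudCoeff_succ_mul k).symm
      · rw [freudForm_freudPoly_of_ne (by omega), freudForm_freudPoly_of_degree_lt]
        · simp
        · rw [degree_mul, degree_X, freudPoly_degree, add_comm]
          exact_mod_cast (by omega : k + 1 < m + 1)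

/-! ### Integration by parts and the Freud equation -/

theorem integral_eval_derivative (f : ℝ[X]) :
    ∫ x : ℝ, f.derivative.eval x * Real.exp (-x ^ 4) =
      ∫ x : ℝ, (4 * X ^ 3 * f).eval x * Real.exp (-x ^ 4) := by
  have hd (x : ℝ) : HasDerivAt (fun x : ℝ => f.eval x * Real.exp (-x ^ 4))
      (f.derivative.eval x * Real.exp (-x ^ 4) - (4 * X ^ 3 * f).eval x * Real.exp (-x ^ 4)) x := by
    have h := (f.hasDerivAt x).mul (((hasDerivAt_pow 4 x).neg).exp)
    refine h.congr_deriv ?_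
    simp
    ring
  have h := integral_eq_zero_of_hasDerivAt_of_integrable hd
    ((integrable_eval_mul_exp _).sub (integrable_eval_mul_exp _)) (integrable_eval_mul_exp f)
  rw [integral_sub (integrable_eval_mul_exp _) (integrable_eval_mul_exp _)] at h
  exact sub_eq_zero.1 h

/-- The factor 4x³ from the weight is split as x²·x so that each side can be expanded by the
recurrence. -/
theorem freudForm_derivative (f g : ℝ[X]) :
    freudForm f.derivative g + freudForm f g.derivative = 4 * freudForm (X ^ 2 * f) (X * g) := by
  have h := integral_eval_derivative (f * g)
  have e (u v : ℝ[X]) : freudForm u v = ∫ x : ℝ, (u * v).eval x * Real.exp (-x ^ 4) := by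
    simp [freudForm_apply]
  rw [derivative_mul] at h
  simp only [eval_add, add_mul] at h
  rw [integral_add (integrable_eval_mul_exp _) (integrable_eval_mul_exp _)] at h
  rw [e, e, h, e, ← integral_const_mul]
  congr 1
  ext x
  simp
  ring

theorem freudForm_derivative_freudPoly_succ (n : ℕ) :
    freudForm (freudPoly (n + 1)).derivative (freudPoly n) = (n + 1) * freudNorm n := by
  have hlc : (freudPoly n).coeff n = 1 := by
    have := freudPoly_monic n
    rwa [Monic, leadingCoeff, freudPoly_natDegree] at this
  have hlc' : (freudPoly (n + 1)).coeff (n + 1) = 1 := by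
    have := freudPoly_monic (n + 1)
    rwa [Monic, leadingCoeff, freudPoly_natDegree] at this
  have hd : ((freudPoly (n + 1)).derivative - (n + 1 : ℝ) • freudPoly n).degree < n := by
    rw [degree_lt_iff_coeff_zero]
    intro j hj
    rw [coeff_sub, coeff_derivative, coeff_smul]
    rcases hj.eq_or_lt with rfl | hj
    · simp [hlc, hlc']
    · rw [coeff_eq_zero_of_natDegree_lt (by rw [freudPoly_natDegree]; omega),
        coeff_eq_zero_of_natDegree_lt (by rw [freudPoly_natDegree]; omega)]
      simp
  have h := freudForm_freudPoly_of_degree_lt hd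
  rw [map_sub, map_smul, LinearMap.sub_apply, LinearMap.smul_apply] at h
  exact sub_eq_zero.1 h

/-- Integration by parts is applied to P_n P_{n+1}. The derivative side is (n + 1) h_n by comparison
of leading coefficients; the other side is expanded in the orthogonal basis and divided by h_n. -/
theorem freud_equation (n : ℕ) :
    4 * freudCoeff (n + 1) * (freudCoeff (n + 2) + freudCoeff (n + 1) + freudCoeff n) = n + 1 := by
  have h := freudForm_derivative (freudPoly n) (freudPoly (n + 1))
  rw [freudForm_symm (freudPoly n), freudForm_derivative_freudPoly_succ,
    freudForm_freudPoly_of_degree_lt ((degree_derivative_lt (freudPoly_monic n).ne_zero).trans (by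
      rw [freudPoly_degree]; exact_mod_cast Nat.lt_succ_self n))] at h
  have e1 : X * freudPoly (n + 1) = freudPoly (n + 2) + freudCoeff (n + 1) • freudPoly n := by
    rw [X_mul_freudPoly, smul_eq_C_mul, Nat.add_sub_cancel]
  have e2 : X ^ 2 * freudPoly n = freudPoly (n + 2) + (freudCoeff (n + 1) + freudCoeff n) •
      freudPoly n + (freudCoeff n * freudCoeff (n - 1)) • freudPoly (n - 2) := by
    have e3 : C (freudCoeff n) * freudPoly (n - 1 + 1) = C (freudCoeff n) * freudPoly n := by
      rcases n with _ | n
      · simp [freudCoeff_zero]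
      · rfl
    rw [sq, mul_assoc, X_mul_freudPoly, mul_add, e1, mul_left_comm, X_mul_freudPoly (n - 1),
      mul_add, e3]
    simp only [smul_eq_C_mul, map_add, map_mul, Nat.sub_sub]
    ring
  -- At n = 0 the truncated index n - 2 equals n, so orthogonality fails and only a_0 = 0 removes
  -- the term.
  have e4 : freudCoeff n * freudForm (freudPoly (n - 2)) (freudPoly n) = 0 := by
    rcases n with _ | n
    · simp [freudCoeff_zero]
    · rw [freudForm_freudPoly_of_ne (by omega), mul_zero]
  have hN := freudNorm_pos n
  have e5 := freudCoeff_succ_mul n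
  have e6 := freudCoeff_succ_mul (n + 1)
  rw [e1, e2] at h
  simp only [map_add, map_smul, LinearMap.add_apply, LinearMap.smul_apply, smul_eq_mul,
    freudForm_freudPoly_of_ne (show n ≠ n + 2 by omega),
    freudForm_freudPoly_of_ne (show n + 2 ≠ n by omega),
    freudForm_freudPoly_of_ne (show n - 2 ≠ n + 2 by omega)] at h
  change 0 + (n + 1) * freudNorm n = 4 * (freudNorm (n + 2) + _ * 0 + _ * 0 +
    _ * (0 + _ * freudNorm n + _)) at h
  apply mul_right_cancel₀ hN.ne'
  rw [← e6, ← e5] at h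
  linear_combination (-1 : ℝ) * h - 4 * freudCoeff (n + 1) * freudCoeff (n - 1) * e4


/-! ### Asymptotics of the recurrence coefficients -/

theorem freudCoeff_le (n : ℕ) : freudCoeff n ≤ Real.sqrt n / 2 := by
  rcases n with _ | n
  · simp [freudCoeff_zero]
  · have h := freud_equation n
    have h0 := freudCoeff_nonneg n
    have h1 := freudCoeff_nonneg (n + 1)
    have h2 := freudCoeff_nonneg (n + 2)
    rw [le_div_iff₀ two_pos]
    apply Real.le_sqrt_of_sq_le
    push_cast
    nlinarith [mul_nonneg h1 h0, mul_nonneg h1 h2]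

theorem tendsto_sqrt_succ_div_sqrt :
    Tendsto (fun n : ℕ => Real.sqrt (n + 1) / Real.sqrt n) atTop (nhds 1) := by
  have h : Tendsto (fun n : ℕ => Real.sqrt (1 + 1 / (n : ℝ))) atTop (nhds 1) := by
    have := (tendsto_one_div_atTop_nhds_zero_nat (𝕜 := ℝ)).const_add 1
    simpa using this.sqrt
  refine h.congr' ?_
  filter_upwards [eventually_gt_atTop 0] with n hn
  have : (0 : ℝ) < n := by exact_mod_cast hn
  rw [← Real.sqrt_div (by positivity)]
  congr 1
  field_simp

/-- A bounded sequence satisfying the rescaled Freud equation in the limit converges. -/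
theorem tendsto_of_mul_add_eq {u v : ℕ → ℝ} (hu0 : ∀ n, 0 ≤ u n) (hu1 : ∀ n, u n ≤ 1 / 2)
    (hv : Tendsto (fun n => v n - (u (n + 2) + u n)) atTop (nhds 0))
    (h : ∀ n, 4 * u (n + 1) * (u (n + 1) + v n) = 1) :
    Tendsto u atTop (nhds (Real.sqrt 12)⁻¹) := by
  have hba : IsBoundedUnder (· ≤ ·) atTop u := isBoundedUnder_of ⟨1 / 2, hu1⟩
  have hbb : IsBoundedUnder (· ≥ ·) atTop u := isBoundedUnder_of ⟨0, hu0⟩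
  set A := limsup u atTop with hA
  set B := liminf u atTop with hB
  have hBA : B ≤ A := liminf_le_limsup hba hbb
  have hB0 : 0 ≤ B := le_liminf_of_le hba.isCoboundedUnder_ge (Eventually.of_forall hu0)
  have hA1 : A ≤ 1 / 2 := limsup_le_of_le hbb.isCoboundedUnder_le (Eventually.of_forall hu1)
  have hle (ε : ℝ) (hε : 0 < ε) : ∀ᶠ n in atTop, u n ≤ A + ε :=
    (eventually_lt_of_limsup_lt (show limsup u atTop < A + ε by linarith) hba).mono fun _ => le_of_lt
  have hge (ε : ℝ) (hε : 0 < ε) : ∀ᶠ n in atTop, B - ε ≤ u n :=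
    (eventually_lt_of_lt_liminf (show B - ε < liminf u atTop by linarith) hbb).mono fun _ => le_of_lt
  have hve (ε : ℝ) (hε : 0 < ε) : ∀ᶠ n in atTop, |v n - (u (n + 2) + u n)| < ε := by
    simpa using Metric.tendsto_atTop.1 hv ε hε
  -- Along indices where u is near its limsup A, both neighbours are at least about B, so 1 ≥ 4A(A +
  -- 2B) up to an error.
  have upper (ε : ℝ) (hε : 0 < ε) : 4 * (A ^ 2 + 2 * A * B) ≤ 1 + 16 * ε := by
    have hf : ∃ᶠ n in atTop, A - ε < u n :=
      frequently_lt_of_lt_limsup hbb.isCoboundedUnder_le (by linarith)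
    have hf' : ∃ᶠ n in atTop, A - ε < u (n + 1) := by
      rw [frequently_atTop] at hf ⊢
      intro a
      obtain ⟨b, hb, h⟩ := hf (a + 1)
      exact ⟨b - 1, by omega, by rwa [Nat.sub_add_cancel (by omega)]⟩
    obtain ⟨n, ⟨h1, h2⟩, h3, h4⟩ := ((hf'.and_eventually (hve ε hε)).and_eventually
      ((hge ε hε).and ((tendsto_add_atTop_nat 2).eventually (hge ε hε)))).exists
    have h5 := (abs_lt.1 h2).1
    have hn := h n
    have hu := hu0 (n + 1)
    have hu' := hu1 (n + 1)
    have e1 : u (n + 1) * (2 * B - 3 * ε) ≤ u (n + 1) * v n :=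
      mul_le_mul_of_nonneg_left (by linarith) hu
    nlinarith [mul_nonneg hB0 (sub_nonneg.2 h1.le), mul_nonneg (hB0.trans hBA) (sub_nonneg.2 h1.le),
      sq_nonneg (u (n + 1) - A), mul_le_mul_of_nonneg_right hu' hε.le,
      mul_le_mul_of_nonneg_right hA1 hε.le, mul_le_mul_of_nonneg_right (hBA.trans hA1) hε.le]
  -- The mirror image: where u is near B, both neighbours are at most about A, so 1 ≤ 4B(B + 2A) up
  -- to an error. The mixed terms of the two bounds agree, and subtraction leaves A² ≤ B².
  have lower (ε : ℝ) (hε : 0 < ε) (hε1 : ε < 1) : 1 ≤ 4 * (B ^ 2 + 2 * A * B) + 24 * ε := by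
    have hf : ∃ᶠ n in atTop, u n < B + ε :=
      frequently_lt_of_liminf_lt hba.isCoboundedUnder_ge (by linarith)
    have hf' : ∃ᶠ n in atTop, u (n + 1) < B + ε := by
      rw [frequently_atTop] at hf ⊢
      intro a
      obtain ⟨b, hb, h⟩ := hf (a + 1)
      exact ⟨b - 1, by omega, by rwa [Nat.sub_add_cancel (by omega)]⟩
    obtain ⟨n, ⟨h1, h2⟩, h3, h4⟩ := ((hf'.and_eventually (hve ε hε)).and_eventually
      ((hle ε hε).and ((tendsto_add_atTop_nat 2).eventually (hle ε hε)))).exists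
    have h5 := (abs_lt.1 h2).2
    have hn := h n
    have hu := hu0 (n + 1)
    have hu' := hu1 (n + 1)
    have e1 : u (n + 1) * v n ≤ u (n + 1) * (2 * A + 3 * ε) :=
      mul_le_mul_of_nonneg_left (by linarith) hu
    have e2 : u (n + 1) ^ 2 ≤ (B + ε) ^ 2 := pow_le_pow_left₀ hu h1.le 2
    nlinarith [mul_nonneg (hB0.trans hBA) (sub_nonneg.2 h1.le),
      mul_le_mul_of_nonneg_right hu' hε.le, mul_le_mul_of_nonneg_left hε1.le hε.le,
      mul_le_mul_of_nonneg_right hA1 hε.le, mul_le_mul_of_nonneg_right (hBA.trans hA1) hε.le]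
  have hAB : A = B := by
    refine le_antisymm ?_ hBA
    have : A ^ 2 ≤ B ^ 2 := by
      refine le_of_forall_pos_lt_add fun ε hε => ?_
      -- The errors add up to 40 times the chosen tolerance; after division by 4, ε/20 yields A² -
      -- B² ≤ ε/2. The cap 1/2 meets the condition ε < 1 of `lower`.
      have h1 := upper (min (ε / 20) (1 / 2)) (by positivity)
      have h2 := lower (min (ε / 20) (1 / 2)) (by positivity)
        ((min_le_right _ _).trans_lt (by norm_num))
      have h3 := min_le_left (ε / 20) (1 / 2 : ℝ)
      linarith
    exact abs_le_of_sq_le_sq' this hB0 |>.2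
  have hlim : Tendsto u atTop (nhds A) := tendsto_of_liminf_eq_limsup hAB.symm rfl hba hbb
  have h12 : 12 * A ^ 2 = 1 := by
    have t1 := hlim.comp (tendsto_add_atTop_nat 1)
    have t2 := hlim.comp (tendsto_add_atTop_nat 2)
    have tv : Tendsto v atTop (nhds (0 + (A + A))) := by
      refine (hv.add (t2.add hlim)).congr fun n => ?_
      simp
    have t3 := (t1.const_mul 4).mul (t1.add tv)
    have t4 := t3.congr (f₂ := fun _ => 1) fun n => h n
    have := tendsto_nhds_unique t4 tendsto_const_nhds
    linarith
  have hAe : A = (Real.sqrt 12)⁻¹ := by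
    rw [← Real.sqrt_inv, eq_comm, Real.sqrt_eq_iff_mul_self_eq (by norm_num) (hB0.trans hBA)]
    linarith
  rwa [← hAe]

theorem tendsto_freudCoeff_div_sqrt :
    Tendsto (fun n : ℕ => freudCoeff n / Real.sqrt n) atTop (nhds (Real.sqrt 12)⁻¹) := by
  set u : ℕ → ℝ := fun n => freudCoeff n / Real.sqrt n with hu
  set s : ℕ → ℝ := fun n => Real.sqrt n with hs
  have hu1 (n : ℕ) : u n ≤ 1 / 2 := by
    rcases (Nat.zero_le n).eq_or_lt with rfl | hn
    · simp [hu]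
    · rw [hu, div_le_iff₀ (Real.sqrt_pos.2 (by exact_mod_cast hn))]
      linarith [freudCoeff_le n]
  have hu0 (n : ℕ) : 0 ≤ u n := div_nonneg (freudCoeff_nonneg n) (Real.sqrt_nonneg _)
  have hr : Tendsto (fun n : ℕ => s (n + 1) / s n) atTop (nhds 1) := by
    simpa [hs] using tendsto_sqrt_succ_div_sqrt
  -- Boundedness of u allows the ratios √(n+2)/√(n+1) and √n/√(n+1) to be replaced by 1 before
  -- convergence of u is known.
  have bdd (w : ℕ → ℕ) (f : ℕ → ℝ) (hf : Tendsto f atTop (nhds 1)) :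
      Tendsto (fun n => u (w n) * (f n - 1)) atTop (nhds 0) := by
    have hf' : Tendsto (fun n => f n - 1) atTop (nhds 0) := by simpa using hf.sub_const 1
    refine squeeze_zero_norm (fun n => ?_) (by simpa using hf'.norm)
    rw [norm_mul, Real.norm_of_nonneg (hu0 _)]
    exact mul_le_of_le_one_left (norm_nonneg _) ((hu1 _).trans (by norm_num))
  have hpos (n : ℕ) : 0 < s (n + 1) := Real.sqrt_pos.2 (by positivity)
  have hsu (n : ℕ) : freudCoeff n = u n * s n := by
    rcases (Nat.zero_le n).eq_or_lt with rfl | hn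
    · simp [freudCoeff_zero, hs]
    · exact (div_mul_cancel₀ _ (Real.sqrt_pos.2 (by exact_mod_cast hn)).ne').symm
  refine tendsto_of_mul_add_eq (v := fun n => (freudCoeff (n + 2) + freudCoeff n) / s (n + 1))
    hu0 hu1 ?_ fun n => ?_
  · have h1 := bdd (fun n => n + 2) _ (hr.comp (tendsto_add_atTop_nat 1))
    have h2 := bdd (fun n => n) _ (by simpa using hr.inv₀ one_ne_zero)
    have h3 := h1.add h2
    rw [add_zero] at h3
    refine h3.congr fun n => ?_
    rw [hsu (n + 2), hsu n]
    have := (hpos n).ne'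
    simp only [Function.comp]
    field_simp
    ring
  · have h := freud_equation n
    have h2 : s (n + 1) ^ 2 = n + 1 := by
      rw [hs, Real.sq_sqrt (by positivity)]
      push_cast
      rfl
    have := (hpos n).ne'
    change 4 * (freudCoeff (n + 1) / s (n + 1)) * (freudCoeff (n + 1) / s (n + 1) + _) = 1
    field_simp
    rw [h2]
    linarith

theorem tendsto_freudCoeff_ratio :
    Tendsto (fun n : ℕ => freudCoeff (n + 1) / freudCoeff (n + 2)) atTop (nhds 1) := by
  have hne : (Real.sqrt 12)⁻¹ ≠ 0 := by positivity
  have h1 := tendsto_freudCoeff_div_sqrt.comp (tendsto_add_atTop_nat 1)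
  have h2 := tendsto_freudCoeff_div_sqrt.comp (tendsto_add_atTop_nat 2)
  have h3 := (tendsto_sqrt_succ_div_sqrt.comp (tendsto_add_atTop_nat 1)).inv₀ one_ne_zero
  have h4 := (h1.div h2 hne).mul h3
  rw [div_self hne, inv_one, one_mul] at h4
  refine h4.congr fun n => ?_
  have e1 : Real.sqrt ((n : ℝ) + 1) ≠ 0 := by positivity
  have e2 : Real.sqrt ((n : ℝ) + 2) ≠ 0 := by positivity
  have e3 := (freudCoeff_succ_pos (n + 1)).ne'
  have e4 : (n : ℝ) + 1 + 1 = n + 2 := by ring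
  simp only [Function.comp, Pi.div_apply, Nat.cast_add, Nat.cast_one, Nat.cast_ofNat, e4]
  field_simp

/-! ### Growth of the diagonal kernel at the origin -/

/-- The coefficients of the reproducing kernel on the diagonal at the origin. -/
def freudDiag (n : ℕ) : ℝ := (freudPoly n).eval 0 ^ 2 / freudNorm n

theorem freudDiag_nonneg (n : ℕ) : 0 ≤ freudDiag n :=
  div_nonneg (sq_nonneg _) (freudNorm_pos n).le

theorem eval_zero_freudPoly_add_two (n : ℕ) :
    (freudPoly (n + 2)).eval 0 = -(freudCoeff (n + 1) * (freudPoly n).eval 0) := by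
  have := congrArg (eval 0) (X_mul_freudPoly (n + 1))
  simp at this
  linarith

/-- Squaring the recurrence at 0 gives a factor a_{n+1}², and h_{n+2} = a_{n+2} a_{n+1} h_n. -/
theorem freudDiag_add_two (n : ℕ) :
    freudDiag (n + 2) = freudCoeff (n + 1) / freudCoeff (n + 2) * freudDiag n := by
  have h0 := (freudNorm_pos n).ne'
  have h1 := (freudCoeff_succ_pos n).ne'
  have h2 := (freudCoeff_succ_pos (n + 1)).ne'
  rw [freudDiag, freudDiag, eval_zero_freudPoly_add_two, ← freudCoeff_succ_mul (n + 1),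
    ← freudCoeff_succ_mul n]
  field_simp

/-- The diagonal kernel grows faster than each of its terms. -/
theorem eventually_mul_freudDiag_le (k : ℕ) :
    ∀ᶠ n in atTop, (k / 2 : ℝ) * freudDiag n ≤ ∑ j ∈ Finset.range n, freudDiag j := by
  induction k with
  | zero =>
    refine Eventually.of_forall fun n => ?_
    simpa using Finset.sum_nonneg fun j _ => freudDiag_nonneg j
  | succ k ih =>
    -- Passing from n to n + 2 adds at least d_n to the sum, while the bound to be reached grows
    -- only by d_n/2; since (k + 1)/2 < k/2 + 1, a ratio close to 1 is harmless.
    have hlim := tendsto_freudCoeff_ratio.mul_const ((k + 1) / 2 : ℝ)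
    have hev := hlim.eventually (ge_mem_nhds (show 1 * ((k + 1) / 2 : ℝ) < k / 2 + 1 by linarith))
    obtain ⟨N, hN⟩ := eventually_atTop.1 (ih.and hev)
    refine eventually_atTop.2 ⟨N + 2, fun m hm => ?_⟩
    obtain ⟨n, rfl⟩ : ∃ n, m = n + 2 := ⟨m - 2, by omega⟩
    obtain ⟨h1, h2⟩ := hN n (by omega)
    rw [Finset.sum_range_succ, Finset.sum_range_succ, freudDiag_add_two]
    have h3 := mul_le_mul_of_nonneg_right h2 (freudDiag_nonneg n)
    have h4 := freudDiag_nonneg (n + 1)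
    push_cast
    linarith


/-! ### The reproducing kernel and the formula for Q_n -/

/-- The reproducing kernel `K_{n-1}(·, 0)` of the polynomials of degree less than `n`. -/
def freudKernel (n : ℕ) : ℝ[X] :=
  ∑ k ∈ Finset.range n, ((freudPoly k).eval 0 / freudNorm k) • freudPoly k

theorem freudKernel_eval_zero (n : ℕ) :
    (freudKernel n).eval 0 = ∑ k ∈ Finset.range n, freudDiag k := by
  rw [freudKernel, eval_finsetSum]
  refine Finset.sum_congr rfl fun k _ => ?_
  rw [eval_smul, freudDiag, smul_eq_mul]
  ring

theorem freudKernel_degree_lt (n : ℕ) : (freudKernel n).degree < n := by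
  refine (degree_sum_le _ _).trans_lt ((Finset.sup_lt_iff (WithBot.bot_lt_coe n)).2 fun k hk => ?_)
  refine (degree_smul_le _ _).trans_lt ?_
  rw [freudPoly_degree]
  exact WithBot.coe_lt_coe.2 (Finset.mem_range.1 hk)

theorem freudForm_freudKernel {n : ℕ} {f : ℝ[X]} (hf : f.degree < n) :
    freudForm (freudKernel n) f = f.eval 0 := by
  have := isMonicOrthogonal_freudPoly.linearMap_eq_zero
    (freudForm (freudKernel n) - leval 0) n (fun k hk => ?_) f hf
  · simpa [sub_eq_zero] using this
  · have hN := (freudNorm_pos k).ne'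
    rw [LinearMap.sub_apply, freudKernel, map_sum, LinearMap.sum_apply,
      Finset.sum_eq_single_of_mem k (Finset.mem_range.2 hk) (fun j _ hj => by
        rw [map_smul, LinearMap.smul_apply, freudForm_freudPoly_of_ne hj, smul_zero]),
      map_smul, LinearMap.smul_apply, smul_eq_mul]
    change _ / _ * freudNorm k - _ = 0
    rw [div_mul_cancel₀ _ hN]
    simp

/-- The Christoffel–Darboux formula at the origin. -/
theorem X_mul_freudKernel (n : ℕ) :
    X * freudKernel (n + 1) = (freudNorm n)⁻¹ • ((freudPoly n).eval 0 • freudPoly (n + 1) -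
      (freudPoly (n + 1)).eval 0 • freudPoly n) := by
  induction n with
  | zero =>
    have h := X_mul_freudPoly 0
    have h1 : (freudPoly 1).eval 0 = 0 := by
      simpa [freudPoly_zero] using eval_zero_freudPoly_mul 0
    simp only [freudCoeff_zero, map_zero, zero_mul, add_zero, zero_add] at h
    simp [freudKernel, ← h, freudPoly_zero, smul_eq_C_mul]
  | succ n ih =>
    have hN := (freudNorm_pos n).ne'
    have hc := (freudCoeff_succ_pos n).ne'
    have hk : freudKernel (n + 1 + 1) = freudKernel (n + 1) +
        ((freudPoly (n + 1)).eval 0 / freudNorm (n + 1)) • freudPoly (n + 1) := by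
      rw [freudKernel, Finset.sum_range_succ, ← freudKernel]
    rw [hk, mul_add, ih, mul_smul_comm, X_mul_freudPoly, Nat.add_sub_cancel, ← smul_eq_C_mul,
      eval_zero_freudPoly_add_two, ← freudCoeff_succ_mul n]
    have e : (freudNorm n)⁻¹ = freudCoeff (n + 1) * (freudCoeff (n + 1) * freudNorm n)⁻¹ := by
      field_simp
    have e' : (freudPoly (n + 1)).eval 0 / (freudCoeff (n + 1) * freudNorm n) =
      (freudCoeff (n + 1) * freudNorm n)⁻¹ * (freudPoly (n + 1)).eval 0 := by
      rw [div_eq_inv_mul]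
    rw [e', e]
    module

/-- One of P_n(0), P_{n+1}(0) vanishes by parity, so multiplication by P_{n+1}(0) kills the P_{n+1}
term of Christoffel–Darboux. -/
theorem X_mul_eval_smul_freudKernel (n : ℕ) :
    X * ((freudPoly (n + 1)).eval 0 • freudKernel (n + 1)) =
      (-(freudCoeff (n + 1) * freudDiag (n + 1))) • freudPoly n := by
  have hN := (freudNorm_pos n).ne'
  have hc := (freudCoeff_succ_pos n).ne'
  rw [mul_smul_comm, X_mul_freudKernel, smul_smul, smul_sub, smul_smul, mul_right_comm,
    eval_zero_freudPoly_mul, zero_mul, zero_smul, zero_sub, smul_smul, ← neg_smul, freudDiag,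
    ← freudCoeff_succ_mul n]
  congr 1
  field_simp

/-- The kernel represents evaluation at 0, so subtracting c·P_n(0)·K_{n-1}(·, 0) restores
orthogonality exactly when c = λ₁(1 - c·K_{n-1}(0, 0)). -/
theorem sobolevPoly_eq (l : ℝ) (hl : 0 ≤ l) (n : ℕ) :
    sobolevPoly l 0 n = freudPoly n - (l / (1 + l * ∑ k ∈ Finset.range n, freudDiag k)) •
      (freudPoly n).eval 0 • freudKernel n := by
  set R : ℕ → ℝ[X] := fun n => freudPoly n -
    (l / (1 + l * ∑ k ∈ Finset.range n, freudDiag k)) • (freudPoly n).eval 0 • freudKernel n with hR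
  suffices h : IsMonicOrthogonal (sobolevForm l 0) R from
    (congrFun ((isMonicOrthogonal_sobolevForm_iff l 0 hl le_rfl R).1 h) n).symm
  have hlt (n : ℕ) : ((l / (1 + l * ∑ k ∈ Finset.range n, freudDiag k)) •
      (freudPoly n).eval 0 • freudKernel n).degree < (freudPoly n).degree := by
    rw [freudPoly_degree]
    exact ((degree_smul_le _ _).trans (degree_smul_le _ _)).trans_lt (freudKernel_degree_lt n)
  have hdeg (n : ℕ) : (R n).degree = n := by
    rw [hR, degree_sub_eq_left_of_degree_lt (hlt n), freudPoly_degree]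
  have key (n : ℕ) (f : ℝ[X]) (hf : f.degree < n) : sobolevForm l 0 (R n) f = 0 := by
    have hpos : 0 < 1 + l * ∑ k ∈ Finset.range n, freudDiag k := by
      have := mul_nonneg hl (Finset.sum_nonneg fun k (_ : k ∈ Finset.range n) => freudDiag_nonneg k)
      linarith
    rw [sobolevForm_apply, ← freudForm_apply, hR]
    simp only [map_sub, map_smul, LinearMap.sub_apply, LinearMap.smul_apply,
      freudForm_freudKernel hf, freudForm_symm (freudPoly n) f,
      freudForm_freudPoly_of_degree_lt hf, eval_sub, eval_smul, smul_eq_mul, freudKernel_eval_zero]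
    field_simp
    ring
  refine ⟨fun n => (freudPoly_monic n).sub_of_left (hlt n),
    fun n => natDegree_eq_of_degree_eq_some (hdeg n), fun m n hmn => ?_⟩
  rcases lt_or_gt_of_ne hmn with h | h
  · rw [sobolevForm_symm]
    exact key n _ (by rw [hdeg]; exact_mod_cast h)
  · exact key m _ (by rw [hdeg]; exact_mod_cast h)

theorem aeval_sobolevPoly_succ (l : ℝ) (hl : 0 ≤ l) (n : ℕ) (z : ℂ) (hz : z ≠ 0) :
    aeval z (sobolevPoly l 0 (n + 1)) = aeval z (freudPoly (n + 1)) +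
      (l * freudDiag (n + 1) / (1 + l * ∑ k ∈ Finset.range (n + 1), freudDiag k) *
        freudCoeff (n + 1) : ℝ) * (aeval z (freudPoly n) / z) := by
  have h := congrArg (aeval z) (X_mul_eval_smul_freudKernel n)
  rw [map_mul, aeval_X, map_smul (aeval z) _ (freudPoly n), Complex.real_smul] at h
  rw [sobolevPoly_eq l hl, map_sub, map_smul (aeval z), Complex.real_smul,
    eq_div_of_mul_eq hz ((mul_comm _ _).trans h)]
  push_cast
  ring

/-! ### Bounds off the numerical range of the Jacobi matrix -/

/-- Off the real segment that contains the numerical range of the Jacobi matrix, the polynomials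
have no zeros and consecutive ones have a bounded quotient. -/
theorem norm_aeval_freudPoly_le {n : ℕ} {L d : ℝ} {z : ℂ} (hd : 0 < d)
    (hL : ∀ k ≤ n, 2 * Real.sqrt (freudCoeff k) ≤ L)
    (hz : ∀ t : ℝ, |t| ≤ L → d ≤ ‖z - t‖) :
    aeval z (freudPoly (n + 1)) ≠ 0 ∧
      d * ‖aeval z (freudPoly n)‖ ≤ ‖aeval z (freudPoly (n + 1))‖ := by
  set p : ℕ → ℂ := fun k => aeval z (freudPoly k) with hp
  set x : ℕ → ℝ := fun k => ‖p k‖ ^ 2 / freudNorm k with hx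
  have hx0 (k : ℕ) : 0 ≤ x k := div_nonneg (sq_nonneg _) (freudNorm_pos k).le
  have hrec (k : ℕ) : z * p k = p (k + 1) + freudCoeff k * p (k - 1) := by
    simpa [hp] using congrArg (aeval z) (X_mul_freudPoly k)
  -- For the vector v of orthonormal polynomials at z, T is the real number ⟨Jv, v⟩ with J the
  -- truncated Jacobi matrix, and z|v|² - ⟨Jv, v⟩ is the boundary term. Each |p_k|²/h_k is charged
  -- at most L/2 by each of its two neighbours; the last has only one, hence the spare L/2 · x m
  -- that feeds the induction.
  have main (m : ℕ) (hm : m ≤ n) : ∃ T : ℝ,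
      z * (∑ k ∈ Finset.range (m + 1), x k : ℝ) =
        p (m + 1) * starRingEnd ℂ (p m) / freudNorm m + T ∧
      |T| ≤ L * ∑ k ∈ Finset.range (m + 1), x k - L / 2 * x m := by
    have hterm (k : ℕ) : z * (x k : ℝ) = z * p k * starRingEnd ℂ (p k) / freudNorm k := by
      rw [hx, mul_assoc, Complex.mul_conj, Complex.normSq_eq_norm_sq]
      push_cast
      ring
    induction m with
    | zero =>
      refine ⟨0, ?_, ?_⟩
      · rw [zero_add, Finset.sum_range_one, hterm, hrec, freudCoeff_zero]
        simp
      · have := hL 0 (Nat.zero_le _)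
        rw [freudCoeff_zero, Real.sqrt_zero, mul_zero] at this
        have := mul_nonneg this (hx0 0)
        simp
        linarith
    | succ m ih =>
      obtain ⟨T, h1, h2⟩ := ih (by omega)
      have hN := freudNorm_pos m
      have hc := freudCoeff_succ_pos m
      have hNc : (freudNorm m : ℂ) ≠ 0 := Complex.ofReal_ne_zero.2 hN.ne'
      have hcc : (freudCoeff (m + 1) : ℂ) ≠ 0 := Complex.ofReal_ne_zero.2 hc.ne'
      set w : ℂ := p (m + 1) * starRingEnd ℂ (p m) with hw
      refine ⟨T + 2 * w.re / freudNorm m, ?_, ?_⟩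
      · have hre : w + starRingEnd ℂ w = ((2 * w.re : ℝ) : ℂ) := Complex.add_conj w
        have hcw : starRingEnd ℂ w = p m * starRingEnd ℂ (p (m + 1)) := by
          rw [hw, map_mul, Complex.conj_conj, mul_comm]
        rw [Finset.sum_range_succ, Complex.ofReal_add, mul_add, h1, hterm, hrec,
          Nat.add_sub_cancel, ← freudCoeff_succ_mul m, Complex.ofReal_add, Complex.ofReal_div, ← hre,
          hcw]
        push_cast
        field_simp
        ring
      · set s := Real.sqrt (freudCoeff (m + 1)) with hs
        have hs2 : s ^ 2 = freudCoeff (m + 1) := Real.sq_sqrt hc.le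
        have hs0 : 0 < s := Real.sqrt_pos.2 hc
        -- AM–GM weighted by √a_{m+1}, which balances the two norms because h_{m+1} = a_{m+1} h_m.
        have hw2 : |2 * w.re / freudNorm m| ≤ s * (x m + x (m + 1)) := by
          have hwn : |w.re| ≤ ‖p (m + 1)‖ * ‖p m‖ := by
            refine (Complex.abs_re_le_norm w).trans ?_
            rw [hw, norm_mul, RCLike.norm_conj]
          have e : s * (x m + x (m + 1)) =
              (s * ‖p m‖ ^ 2 + ‖p (m + 1)‖ ^ 2 / s) / freudNorm m := by
            simp only [hx]
            rw [← freudCoeff_succ_mul m, ← hs2]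
            field_simp
          rw [e, abs_div, abs_of_pos hN, abs_mul, abs_two]
          gcongr
          have e2 : s * ‖p m‖ ^ 2 + ‖p (m + 1)‖ ^ 2 / s - 2 * (‖p (m + 1)‖ * ‖p m‖) =
              (s * ‖p m‖ - ‖p (m + 1)‖) ^ 2 / s := by
            field_simp
            ring
          have : 0 ≤ (s * ‖p m‖ - ‖p (m + 1)‖) ^ 2 / s := by positivity
          linarith
        have hsL : s * (x m + x (m + 1)) ≤ L / 2 * (x m + x (m + 1)) :=
          mul_le_mul_of_nonneg_right (by linarith [hL (m + 1) hm])
            (add_nonneg (hx0 m) (hx0 (m + 1)))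
        rw [Finset.sum_range_succ]
        have := abs_add_le T (2 * w.re / freudNorm m)
        linarith
  obtain ⟨T, h1, h2⟩ := main n le_rfl
  set S := ∑ k ∈ Finset.range (n + 1), x k with hS
  have hN := freudNorm_pos n
  have hL0 : 0 ≤ L := by simpa [freudCoeff_zero] using hL 0 (Nat.zero_le _)
  have hS0 : 0 < S := by
    refine Finset.sum_pos' (fun k _ => hx0 k) ⟨0, by simp, ?_⟩
    have := freudNorm_pos 0
    simp [hx, hp, freudPoly_zero, this]
  have hxS : x n ≤ S := Finset.single_le_sum (fun k _ => hx0 k) (by simp)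
  have hT : |T / S| ≤ L := by
    rw [abs_div, abs_of_pos hS0, div_le_iff₀ hS0]
    have := mul_nonneg hL0 (hx0 n)
    linarith
  -- T/S is a Rayleigh quotient in [-L, L], so z has distance at least d from it. Positivity of S
  -- then excludes a zero of P_{n+1}, and S ≥ |p_n|²/h_n gives the quotient bound.
  have h3 : d * S ≤ ‖p (n + 1)‖ * ‖p n‖ / freudNorm n := by
    have e : (z - (T / S : ℝ)) * S = p (n + 1) * starRingEnd ℂ (p n) / freudNorm n := by
      have : (S : ℂ) ≠ 0 := Complex.ofReal_ne_zero.2 hS0.ne'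
      rw [sub_mul, h1]
      push_cast
      rw [div_mul_cancel₀ _ this, add_sub_cancel_right]
    have e2 := congrArg norm e
    rw [norm_mul, norm_div, norm_mul, RCLike.norm_conj, Complex.norm_real, Complex.norm_real,
      Real.norm_of_nonneg hS0.le, Real.norm_of_nonneg hN.le] at e2
    rw [← e2]
    exact mul_le_mul_of_nonneg_right (hz _ hT) hS0.le
  constructor
  · intro h0
    rw [show p (n + 1) = 0 from h0] at h3
    have := mul_pos hd hS0
    simp at h3
    linarith
  · have h4 : d * x n ≤ ‖p (n + 1)‖ * ‖p n‖ / freudNorm n :=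
      (mul_le_mul_of_nonneg_left hxS hd.le).trans h3
    rw [hx, ← mul_div_assoc, div_le_div_iff_of_pos_right hN, sq, ← mul_assoc] at h4
    rcases (norm_nonneg (p n)).eq_or_lt with h5 | h5
    · change d * ‖p n‖ ≤ _
      rw [← h5, mul_zero]
      exact norm_nonneg _
    · exact le_of_mul_le_mul_right h4 h5


/-! ### The limit function is constant -/

theorem phi_sq_add_one {z : ℂ} (hz : z ∉ realSegment 1) : 1 + phi z ^ 2 = 2 * z * phi z := by
  linear_combination phi_sub_sq hz

theorem twelve_rpow_mul_phi {x : ℂ} (hx : x ∉ realSegment ((4 / 3 : ℝ) ^ (1 / 4 : ℝ))) :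
    (((12 : ℝ) ^ (1 / 4 : ℝ) : ℝ) : ℂ) *
      (x * phi ((((3 / 4 : ℝ) ^ (1 / 4 : ℝ) : ℝ) : ℂ) * x) /
        (1 + phi ((((3 / 4 : ℝ) ^ (1 / 4 : ℝ) : ℝ) : ℂ) * x) ^ 2)) = 1 := by
  set b : ℝ := (3 / 4 : ℝ) ^ (1 / 4 : ℝ) with hb
  have hb0 : 0 < b := by positivity
  have ha : (4 / 3 : ℝ) ^ (1 / 4 : ℝ) = b⁻¹ := by
    rw [hb, ← Real.inv_rpow (by norm_num)]
    norm_num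
  have h12 : (12 : ℝ) ^ (1 / 4 : ℝ) = 2 * b := by
    rw [show (12 : ℝ) = 2 ^ (4 : ℝ) * (3 / 4) by norm_num, Real.mul_rpow (by norm_num) (by norm_num),
      ← Real.rpow_mul (by norm_num)]
    norm_num [← hb]
  have hbc : (b : ℂ) ≠ 0 := Complex.ofReal_ne_zero.2 hb0.ne'
  have hz : (b : ℂ) * x ∉ realSegment 1 := by
    rintro ⟨t, ⟨ht1, ht2⟩, hte⟩
    refine hx ⟨b⁻¹ * t, ⟨?_, ?_⟩, ?_⟩
    · rw [ha, ← mul_neg_one]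
      exact mul_le_mul_of_nonneg_left ht1 (inv_pos.2 hb0).le
    · rw [ha]
      exact mul_le_of_le_one_right (inv_pos.2 hb0).le ht2
    · change ((b⁻¹ * t : ℝ) : ℂ) = x
      change (t : ℂ) = b * x at hte
      rw [Complex.ofReal_mul, hte, Complex.ofReal_inv, inv_mul_cancel_left₀ hbc]
  have hz0 := ne_zero_of_notMem_realSegment hz
  have hx0 : x ≠ 0 := right_ne_zero_of_mul hz0
  have hphi := phi_sq_add_one hz
  have hphi0 : phi (b * x) ≠ 0 := by
    intro h
    rw [h] at hphi
    simp at hphi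
  rw [hphi, h12]
  push_cast
  field_simp

/-! ### Rescaling and uniform estimates -/

theorem natCast_rpow_sq (n : ℕ) : ((n : ℝ) ^ (1 / 4 : ℝ)) ^ 2 = Real.sqrt n := by
  rw [← Real.rpow_natCast, ← Real.rpow_mul n.cast_nonneg, Real.sqrt_eq_rpow]
  norm_num

/-- The constant is 2·12^(-1/4) = (4/3)^(1/4), and k^(1/4) increases with k. The finitely many k
below the asymptotic range are absorbed because n^(1/4) tends to infinity. -/
theorem eventually_two_mul_sqrt_freudCoeff_le {ε : ℝ} (hε : 0 < ε) :
    ∀ᶠ n : ℕ in atTop, ∀ k ≤ n, 2 * Real.sqrt (freudCoeff k) ≤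
      (n : ℝ) ^ (1 / 4 : ℝ) * ((4 / 3 : ℝ) ^ (1 / 4 : ℝ) + ε) := by
  set a : ℝ := (4 / 3 : ℝ) ^ (1 / 4 : ℝ) with ha
  have ha0 : 0 < a := by positivity
  have ha2 : (Real.sqrt 12)⁻¹ = (a / 2) ^ 2 := by
    have h : (a ^ 2) ^ 2 = 4 / 3 := by
      rw [← pow_mul, ha, ← Real.rpow_natCast, ← Real.rpow_mul (by norm_num)]
      norm_num
    rw [← Real.sqrt_inv, Real.sqrt_eq_iff_mul_self_eq (by norm_num) (by positivity)]
    linarith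
  have hlt : (Real.sqrt 12)⁻¹ < ((a + ε) / 2) ^ 2 := by
    rw [ha2]
    gcongr
    linarith
  have hmono {k n : ℕ} (h : k ≤ n) : (k : ℝ) ^ (1 / 4 : ℝ) ≤ (n : ℝ) ^ (1 / 4 : ℝ) :=
    Real.rpow_le_rpow k.cast_nonneg (by exact_mod_cast h) (by norm_num)
  obtain ⟨N, hN⟩ := eventually_atTop.1
    ((tendsto_freudCoeff_div_sqrt.eventually (ge_mem_nhds hlt)).and (eventually_gt_atTop 0))
  have htop : Tendsto (fun n : ℕ => (n : ℝ) ^ (1 / 4 : ℝ) * (a + ε)) atTop atTop :=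
    ((tendsto_rpow_atTop (by norm_num)).comp tendsto_natCast_atTop_atTop).atTop_mul_const
      (by positivity)
  filter_upwards [htop.eventually_ge_atTop (∑ k ∈ Finset.range N, 2 * Real.sqrt (freudCoeff k))]
    with n hn k hk
  rcases lt_or_ge k N with h | h
  · exact (Finset.single_le_sum (f := fun k => 2 * Real.sqrt (freudCoeff k))
      (fun j _ => by positivity) (Finset.mem_range.2 h)).trans hn
  · obtain ⟨h1, h2⟩ := hN k h
    have hk0 : (0 : ℝ) < k := by exact_mod_cast h2
    rw [div_le_iff₀ (Real.sqrt_pos.2 hk0), ← natCast_rpow_sq, ← mul_pow] at h1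
    have h3 := (Real.sqrt_le_left (by positivity)).2 h1
    have h4 := mul_le_mul_of_nonneg_right (hmono hk) (show 0 ≤ a + ε by positivity)
    linarith

theorem exists_forall_le_norm_sub {K : Set ℂ} (hK : IsCompact K) {a : ℝ}
    (hKs : K ⊆ (realSegment a)ᶜ) :
    ∃ δ > 0, ∀ x ∈ K, ∀ t : ℝ, |t| ≤ a → δ ≤ ‖x - t‖ := by
  have hc : IsCompact (realSegment a) := isCompact_Icc.image Complex.continuous_ofReal
  obtain ⟨δ, hδ, h⟩ := hK.exists_thickening_subset_open hc.isClosed.isOpen_compl hKs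
  refine ⟨δ, hδ, fun x hx t ht => ?_⟩
  by_contra! hlt
  refine h (Metric.mem_thickening_iff.2 ⟨x, hx, ?_⟩) ⟨t, abs_le.1 ht, rfl⟩
  rwa [dist_comm, dist_eq_norm]

theorem le_norm_mul_sub {x : ℂ} {a δ r : ℝ} (ha : 0 ≤ a) (hr : 0 < r) (hδ : 0 < δ)
    (hx : ∀ t : ℝ, |t| ≤ a → δ ≤ ‖x - t‖) (t : ℝ) (ht : |t| ≤ r * (a + δ / 2)) :
    r * (δ / 2) ≤ ‖r * x - t‖ := by
  have hrc : (r : ℂ) ≠ 0 := Complex.ofReal_ne_zero.2 hr.ne'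
  obtain ⟨s, rfl⟩ : ∃ s, t = r * s := ⟨t / r, by field_simp⟩
  rw [abs_mul, abs_of_pos hr] at ht
  have hs := abs_le.1 (le_of_mul_le_mul_left ht hr)
  -- u is the projection of s = t/r onto [-a, a]; half of the distance δ is lost in moving from u to
  -- s.
  obtain ⟨u, hu, hus⟩ : ∃ u : ℝ, |u| ≤ a ∧ |s - u| ≤ δ / 2 := by
    rcases le_total s (-a) with h | h
    · exact ⟨-a, by rw [abs_neg, abs_of_nonneg ha], abs_le.2 ⟨by linarith, by linarith⟩⟩
    · rcases le_total s a with h' | h'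
      · exact ⟨s, abs_le.2 ⟨h, h'⟩, by rw [sub_self, abs_zero]; positivity⟩
      · exact ⟨a, (abs_of_nonneg ha).le, abs_le.2 ⟨by linarith, by linarith⟩⟩
  have h1 : ‖x - u‖ ≤ ‖x - s‖ + |s - u| := by
    rw [← Real.norm_eq_abs, ← Complex.norm_real, Complex.ofReal_sub]
    exact norm_sub_le_norm_sub_add_norm_sub _ _ _
  rw [Complex.ofReal_mul, ← mul_sub, norm_mul, Complex.norm_real, Real.norm_of_nonneg hr.le]
  exact mul_le_mul_of_nonneg_left (by linarith [hx u hu]) hr.le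

/-- The bound for the rescaled polynomials on sets away from the limiting interval of zeros. -/
theorem eventually_norm_aeval_freudPoly_le {K : Set ℂ} {δ : ℝ} (hδ : 0 < δ)
    (hK : ∀ x ∈ K, ∀ t : ℝ, |t| ≤ (4 / 3 : ℝ) ^ (1 / 4 : ℝ) → δ ≤ ‖x - t‖) :
    ∀ᶠ n : ℕ in atTop, ∀ x ∈ K,
      aeval ((((n : ℝ) ^ (1 / 4 : ℝ) : ℝ) : ℂ) * x) (freudPoly n) ≠ 0 ∧
      (n : ℝ) ^ (1 / 4 : ℝ) * (δ / 2) *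
          ‖aeval ((((n : ℝ) ^ (1 / 4 : ℝ) : ℝ) : ℂ) * x) (freudPoly (n - 1))‖ ≤
        ‖aeval ((((n : ℝ) ^ (1 / 4 : ℝ) : ℝ) : ℂ) * x) (freudPoly n)‖ := by
  filter_upwards [eventually_two_mul_sqrt_freudCoeff_le (half_pos hδ), eventually_gt_atTop 0]
    with n hn hn0 x hx
  have hr : 0 < (n : ℝ) ^ (1 / 4 : ℝ) := Real.rpow_pos_of_pos (by exact_mod_cast hn0) _
  have h := norm_aeval_freudPoly_le (n := n - 1) (mul_pos hr (half_pos hδ))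
    (fun k hk => hn k (by omega)) (le_norm_mul_sub (by positivity) hr hδ (hK x hx))
  rwa [Nat.sub_add_cancel hn0] at h

theorem eventually_mul_freudDiag_div_le (l : ℝ) (hl : 0 ≤ l) {ε : ℝ} (hε : 0 < ε) :
    ∀ᶠ n in atTop, l * freudDiag n / (1 + l * ∑ k ∈ Finset.range n, freudDiag k) ≤ ε := by
  -- With d_n at most 2/k times the sum, k > 2/ε makes the quotient at most ε.
  obtain ⟨k, hk⟩ := exists_nat_gt (2 / ε)
  rw [div_lt_iff₀ hε] at hk
  filter_upwards [eventually_mul_freudDiag_le k] with n hn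
  have hS := mul_nonneg hl (Finset.sum_nonneg fun k (_ : k ∈ Finset.range n) => freudDiag_nonneg k)
  rw [div_le_iff₀ (by linarith)]
  have h1 := mul_le_mul_of_nonneg_left hn (mul_nonneg hl hε.le)
  have h2 := mul_le_mul_of_nonneg_right hk.le (mul_nonneg hl (freudDiag_nonneg n))
  linarith

theorem norm_sobolevPoly_div_sub_one_le {l δ r e : ℝ} (hl : 0 ≤ l) (hδ : 0 < δ) (hr : 0 < r)
    {n : ℕ} (hn : 0 < n) (hrn : r ^ 2 = Real.sqrt n)
    (he : l * freudDiag n / (1 + l * ∑ k ∈ Finset.range n, freudDiag k) ≤ e) {z : ℂ}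
    (hz : r * δ ≤ ‖z‖) (h0 : aeval z (freudPoly n) ≠ 0)
    (hP : r * (δ / 2) * ‖aeval z (freudPoly (n - 1))‖ ≤ ‖aeval z (freudPoly n)‖) :
    ‖aeval z (sobolevPoly l 0 n) / aeval z (freudPoly n) - 1‖ ≤ e / δ ^ 2 := by
  obtain ⟨m, rfl⟩ : ∃ m, n = m + 1 := ⟨n - 1, by omega⟩
  rw [Nat.add_sub_cancel] at hP
  have hz0 : z ≠ 0 := norm_pos_iff.1 ((mul_pos hr hδ).trans_le hz)
  set f := l * freudDiag (m + 1) / (1 + l * ∑ k ∈ Finset.range (m + 1), freudDiag k) with hf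
  have hf0 : 0 ≤ f := by
    have hS := mul_nonneg hl
      (Finset.sum_nonneg fun k (_ : k ∈ Finset.range (m + 1)) => freudDiag_nonneg k)
    exact div_nonneg (mul_nonneg hl (freudDiag_nonneg _)) (by linarith)
  have hc := freudCoeff_le (m + 1)
  have hc0 := freudCoeff_nonneg (m + 1)
  rw [← hrn] at hc
  have hPn := norm_pos_iff.2 h0
  rw [aeval_sobolevPoly_succ l hl m z hz0, add_div, div_self h0, add_sub_cancel_left, norm_div,
    norm_mul, norm_div, Complex.norm_real, Real.norm_of_nonneg (mul_nonneg hf0 hc0),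
    div_le_iff₀ hPn]
  have h1 : ‖aeval z (freudPoly m)‖ / ‖z‖ ≤
      ‖aeval z (freudPoly (m + 1))‖ / (r * (δ / 2)) / (r * δ) := by
    refine div_le_div₀ (by positivity) ?_ (mul_pos hr hδ) hz
    rw [le_div_iff₀ (by positivity)]
    linarith
  -- The powers of r cancel: a_n contributes r²/2, the quotient of consecutive polynomials 2/(rδ),
  -- and 1/|z| at most 1/(rδ).
  calc f * freudCoeff (m + 1) * (‖aeval z (freudPoly m)‖ / ‖z‖)
      ≤ e * (r ^ 2 / 2) * (‖aeval z (freudPoly (m + 1))‖ / (r * (δ / 2)) / (r * δ)) := by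
        have := hf0.trans he
        gcongr
    _ = e / δ ^ 2 * ‖aeval z (freudPoly (m + 1))‖ := by
        field_simp

end FreudSobolev

end

theorem mainTheorem1 (l₁ : ℝ) (hl₁ : 0 ≤ l₁) (K : Set ℂ) (hK : IsCompact K)
    (hKs : K ⊆ (FreudSobolev.realSegment ((4 / 3 : ℝ) ^ (1 / 4 : ℝ)))ᶜ) :
    (∀ᶠ n : ℕ in Filter.atTop, ∀ x ∈ K,
      Polynomial.aeval ((((n : ℝ) ^ (1 / 4 : ℝ) : ℝ) : ℂ) * x) (FreudSobolev.freudPoly n) ≠ 0) ∧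
    TendstoUniformlyOn
      (fun (n : ℕ) (x : ℂ) =>
        Polynomial.aeval ((((n : ℝ) ^ (1 / 4 : ℝ) : ℝ) : ℂ) * x) (FreudSobolev.sobolevPoly l₁ 0 n) /
          Polynomial.aeval ((((n : ℝ) ^ (1 / 4 : ℝ) : ℝ) : ℂ) * x) (FreudSobolev.freudPoly n))
      (fun x : ℂ =>
        (((12 : ℝ) ^ (1 / 4 : ℝ) : ℝ) : ℂ) *
          (x * FreudSobolev.phi ((((3 / 4 : ℝ) ^ (1 / 4 : ℝ) : ℝ) : ℂ) * x) /
            (1 + FreudSobolev.phi ((((3 / 4 : ℝ) ^ (1 / 4 : ℝ) : ℝ) : ℂ) * x) ^ 2)))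
      Filter.atTop K := by
  obtain ⟨δ, hδ, hd⟩ := FreudSobolev.exists_forall_le_norm_sub hK hKs
  have hev := FreudSobolev.eventually_norm_aeval_freudPoly_le hδ hd
  refine ⟨hev.mono fun n h x hx => (h x hx).1, ?_⟩
  rw [Metric.tendstoUniformlyOn_iff]
  intro ε hε
  filter_upwards [hev, FreudSobolev.eventually_mul_freudDiag_div_le l₁ hl₁
    (show 0 < ε / 2 * δ ^ 2 by positivity), eventually_gt_atTop 0] with n hP hD hn x hx
  have hr : 0 < (n : ℝ) ^ (1 / 4 : ℝ) := Real.rpow_pos_of_pos (by exact_mod_cast hn) _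
  have hz : (n : ℝ) ^ (1 / 4 : ℝ) * δ ≤ ‖(((n : ℝ) ^ (1 / 4 : ℝ) : ℝ) : ℂ) * x‖ := by
    rw [norm_mul, Complex.norm_real, Real.norm_of_nonneg hr.le]
    refine mul_le_mul_of_nonneg_left ?_ hr.le
    simpa using hd x hx 0 (by rw [abs_zero]; positivity)
  rw [FreudSobolev.twelve_rpow_mul_phi (hKs hx), dist_comm, dist_eq_norm]
  refine (FreudSobolev.norm_sobolevPoly_div_sub_one_le hl₁ hδ hr hn
    (FreudSobolev.natCast_rpow_sq n) hD hz (hP x hx).1 (hP x hx).2).trans_lt ?_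
  rw [mul_div_cancel_right₀ _ (by positivity)]
  linarith
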